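/- Let $n\ge 2$. For complex symmetric $n\times n$ matrices $A,B,S$ put $\Sigma=xA+yB$, $P(x,y)=\det\Sigma$, $T(x,y)=\operatorname{tr}(S\operatorname{adj}\Sigma)$ and \[ f=PP_x+PT_x-TP_x,\qquad g=PP_y+PT_y-TP_y , \] where subscripts denote partial derivatives, and let $F(x,y,z)$ and $G(x,y,z)$ be the homogenizations of $f$ and $g$ with respect to $z$. For $q\in\mathbb{CP}^2$ let $I_q(F,G)$ denote the intersection multiplicity of $F$ and $G$ at $q$, that is, the dimension over $\mathbb C$ of the local ring of $\mathbb{CP}^2$ at $q$ modulo the ideal generated by (dehomogenizations of) $F$ and $G$. Let $V(F,G,z)\subset\mathbb{CP}^2$ be the set of common points of $F$ and $G$ on the line at infinity $z=0$. Then there is a non-empty Zariski open subset of the affine space of triples $(A,B,S)$ of complex symmetric $n\times n$ matrices such that for every triple in it: 1. $V(F,G,z)$ consists of exactly $n$ points; 2. $[q_1:q_2]\mapsto[q_1:q_2:0]$ is a bijection from the set of zeros of $P$ in $\mathbb{CP}^1$ onto $V(F,G,z)$; 3. $I_q(F,G)=2$ for every $q\in V(F,G,z)$; 4. consequently $\sum_{q\in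 V(F,G,z)}I_q(F,G)=2n$. -/

import Mathlib

noncomputable section

namespace CovarianceCurves

open MvPolynomial

/-- A subset of affine space `ℂ^ι` is Zariski open if it is the complement of the set of common
zeros of finitely many polynomials. -/
def IsZariskiOpen {ι : Type} (U : Set (ι → ℂ)) : Prop :=
  ∃ s : Finset (MvPolynomial ι ℂ), U = {x | ∀ p ∈ s, eval x p = 0}ᶜ

/-- The symmetric matrix with the given entries on and above the diagonal: coordinates on the space
of symmetric matrices are indexed by unordered pairs of indices. -/
def symmetricMatrix {n : ℕ} (c : Sym2 (Fin n) → ℂ) : Matrix (Fin n) (Fin n) ℂ :=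
  Matrix.of fun i j => c s(i, j)

/-- A property of triples `(A, B, S)` of complex symmetric `n × n` matrices holds generically if it
holds on a non-empty Zariski open subset of the affine space of all such triples. -/
def HoldsGenerically (n : ℕ)
    (Q : Matrix (Fin n) (Fin n) ℂ → Matrix (Fin n) (Fin n) ℂ → Matrix (Fin n) (Fin n) ℂ → Prop) :
    Prop :=
  ∃ U : Set (Fin 3 × Sym2 (Fin n) → ℂ), IsZariskiOpen U ∧ U.Nonempty ∧
    ∀ c ∈ U, Q (symmetricMatrix fun e => c (0, e)) (symmetricMatrix fun e => c (1, e))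
      (symmetricMatrix fun e => c (2, e))

section ScoreEquations

variable {n : ℕ} (A B S : Matrix (Fin n) (Fin n) ℂ)

/-- `Σ = x A + y B`, with entries in `ℂ[x, y]`; here `x = X 0` and `y = X 1`. -/
def covMatrix : Matrix (Fin n) (Fin n) (MvPolynomial (Fin 2) ℂ) :=
  (X 0 : MvPolynomial (Fin 2) ℂ) • A.map C + (X 1 : MvPolynomial (Fin 2) ℂ) • B.map C

/-- `P = det Σ`. -/
def polyP : MvPolynomial (Fin 2) ℂ := (covMatrix A B).det

/-- `T = tr (S adj Σ)`. -/
def polyT : MvPolynomial (Fin 2) ℂ := (S.map C * (covMatrix A B).adjugate).trace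

/-- The score equation with respect to the `i`-th variable, with denominators cleared:
`P P_i + P T_i - T P_i`. -/
def scorePoly (i : Fin 2) : MvPolynomial (Fin 2) ℂ :=
  polyP A B * pderiv i (polyP A B) + polyP A B * pderiv i (polyT A B S)
    - polyT A B S * pderiv i (polyP A B)

end ScoreEquations

/-- The homogenization `z ^ d * p (x / z, y / z)`, where `d` is the total degree of `p`; the
homogeneous coordinates are `x = X 0`, `y = X 1`, `z = X 2`. -/
def homogenization (p : MvPolynomial (Fin 2) ℂ) : MvPolynomial (Fin 3) ℂ :=
  ∑ k ∈ Finset.range (p.totalDegree + 1),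
    rename Fin.castSucc (homogeneousComponent k p) * X 2 ^ (p.totalDegree - k)

/-- `F`, the homogenization of `f = P P_x + P T_x - T P_x`. -/
def curveF {n : ℕ} (A B S : Matrix (Fin n) (Fin n) ℂ) : MvPolynomial (Fin 3) ℂ :=
  homogenization (scorePoly A B S 0)

/-- `G`, the homogenization of `g = P P_y + P T_y - T P_y`. -/
def curveG {n : ℕ} (A B S : Matrix (Fin n) (Fin n) ℂ) : MvPolynomial (Fin 3) ℂ :=
  homogenization (scorePoly A B S 1)

/-- The complex projective line. -/
abbrev ProjLine : Type := Projectivization ℂ (Fin 2 → ℂ)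

/-- The complex projective plane. -/
abbrev ProjPlane : Type := Projectivization ℂ (Fin 3 → ℂ)

/-- The linear map `(a, b) ↦ (a, b, 0)`. -/
def appendZero : (Fin 2 → ℂ) →ₗ[ℂ] (Fin 3 → ℂ) where
  toFun v := ![v 0, v 1, 0]
  map_add' v w := by simp
  map_smul' c v := by simp

theorem appendZero_injective : Function.Injective appendZero := by
  intro v w h
  have h0 := congrFun h 0
  have h1 := congrFun h 1
  ext i
  fin_cases i
  · simpa [appendZero] using h0
  · simpa [appendZero] using h1

/-- The embedding `[a : b] ↦ [a : b : 0]` of the projective line as the line at infinity. -/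
def toInfinity : ProjLine → ProjPlane :=
  Projectivization.map appendZero appendZero_injective

/-- The zeros of a (homogeneous) form on the projective line. -/
def projRoots (p : MvPolynomial (Fin 2) ℂ) : Set ProjLine :=
  {q | eval q.rep p = 0}

/-- `V(F, G, z)`: the common points at infinity of two (homogeneous) plane curves. -/
def meetAtInfinity (F G : MvPolynomial (Fin 3) ℂ) : Set ProjPlane :=
  {q | eval q.rep F = 0 ∧ eval q.rep G = 0 ∧ q.rep 2 = 0}

instance isPrime_ker_eval (a : Fin 2 → ℂ) :
    (RingHom.ker (eval a : MvPolynomial (Fin 2) ℂ →+* ℂ)).IsPrime :=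
  RingHom.ker_isPrime _

/-- The local ring of the affine plane at the point `a`. -/
abbrev LocalRingAt (a : Fin 2 → ℂ) : Type :=
  Localization.AtPrime (RingHom.ker (eval a : MvPolynomial (Fin 2) ℂ →+* ℂ))

/-- The ideal generated by `f` and `g` in the local ring of the affine plane at `a`. -/
def localIdeal (a : Fin 2 → ℂ) (f g : MvPolynomial (Fin 2) ℂ) : Ideal (LocalRingAt a) :=
  Ideal.span {algebraMap _ (LocalRingAt a) f, algebraMap _ (LocalRingAt a) g}

/-- The intersection multiplicity of the affine plane curves `f` and `g` at `a`: the (possibly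
infinite) dimension over `ℂ` of the local ring at `a` modulo `(f, g)`. -/
def affineIntersectionMultiplicity (a : Fin 2 → ℂ) (f g : MvPolynomial (Fin 2) ℂ) : ℕ∞ :=
  Cardinal.toENat (Module.rank ℂ (LocalRingAt a ⧸ localIdeal a f g))

/-- The polynomial obtained by setting the `i`-th of three variables equal to `1`. -/
def dehomogenize (i : Fin 3) (F : MvPolynomial (Fin 3) ℂ) : MvPolynomial (Fin 2) ℂ :=
  aeval (i.insertNth (α := fun _ => MvPolynomial (Fin 2) ℂ) 1 X) F

open Classical in
/-- The index of the first non-zero homogeneous coordinate of a point of the projective plane. -/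
def firstChart (q : ProjPlane) : Fin 3 :=
  if q.rep 0 ≠ 0 then 0 else if q.rep 1 ≠ 0 then 1 else 2

/-- The affine coordinates of a point in the standard chart where the `i`-th coordinate is `1`. -/
def chartPoint (i : Fin 3) (q : ProjPlane) : Fin 2 → ℂ :=
  fun j => q.rep (i.succAbove j) / q.rep i

/-- The intersection multiplicity `I_q(F, G)` of two projective plane curves at `q`, computed in a
standard affine chart containing `q` (as is well known, it does not depend on the chart). -/
def intersectionMultiplicity (q : ProjPlane) (F G : MvPolynomial (Fin 3) ℂ) : ℕ∞ :=
  affineIntersectionMultiplicity (chartPoint (firstChart q) q)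
    (dehomogenize (firstChart q) F) (dehomogenize (firstChart q) G)

end CovarianceCurves

end

/-! Since `P` and `T` are forms of degrees `n` and `n - 1`, the score polynomials have a part `P
P_i` of degree `2n - 1` and a part `P T_i - T P_i` of degree `2n - 2`. If `P P_i ≠ 0`, the
homogenization is `P P_i + z (P T_i - T P_i)` (`scoreForm`). On `z = 0` the curves become `P P_x`
and `P P_y`, and Euler's identity gives `x P P_x + y P P_y = n P²`, so the common points at infinity
are the zeros of `P`.

For the multiplicity at such a point, let `P` have a simple root there and `T` not vanish. In the
chart `x = 1`, with local parameters `u = y - a` and `z`, Euler's identity turns `F + y G` into `n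
P² - z P T`. Eliminating against `G` puts `u²`, then `uz`, then `z²` in the ideal `(F, G)`
(`mem_span_pair_of_local_equations`). Modulo the squared maximal ideal, `F` is `-a` times `G` and
`G` has nonzero linear part. So the quotient of the local ring is the ring of dual numbers, of
dimension 2 (`affineIntersectionMultiplicity_eq_two`).

The open set is the nonvanishing locus of `det A * det B * Res(P(1,t), P'(1,t) T(1,t))`. The factor
`det A` gives `P_x ≠ 0`; `det B` gives `P_y ≠ 0`, keeps `[0:1]` off the zeros of `P` and makes
`P(1,t)` of degree `n`; the resultant makes roots simple and not roots of `T`. The set is non-empty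
because `A = diag(1,…,n)`, `B = S = 1` lies in it: there `T(1,t) = P'(1,t)`. -/

noncomputable section

namespace CovarianceCurves

open MvPolynomial

/-! ### First-order jets and a criterion for intersection multiplicity two -/

/-- The maximal ideal of the point `a` of the affine plane. -/
def pointIdeal (a : Fin 2 → ℂ) : Ideal (MvPolynomial (Fin 2) ℂ) :=
  Ideal.span (Set.range fun i => X i - C (a i))

theorem X_sub_C_mem_pointIdeal (a : Fin 2 → ℂ) (i : Fin 2) : X i - C (a i) ∈ pointIdeal a :=
  Ideal.subset_span ⟨i, rfl⟩

/-- The first order Taylor expansion of a polynomial at a point. -/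
theorem sub_linear_mem_pointIdeal_sq (a : Fin 2 → ℂ) (h : MvPolynomial (Fin 2) ℂ) :
    h - C (eval a h) - ∑ i, C (eval a (pderiv i h)) * (X i - C (a i)) ∈ pointIdeal a ^ 2 := by
  induction h using MvPolynomial.induction_on with
  | C c => simp
  | add p q hp hq =>
    convert add_mem hp hq using 1
    simp only [map_add, add_mul, Finset.sum_add_distrib]
    ring
  | mul_X p k hp =>
    have hlin : ∑ i, C (eval a (pderiv i p)) * (X i - C (a i)) ∈ pointIdeal a :=
      Ideal.sum_mem _ fun i _ => Ideal.mul_mem_left _ _ (X_sub_C_mem_pointIdeal a i)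
    -- For `p * X k`, the remainder is `X k` times that of `p`, plus `X k - a k` times the linear
    -- part of `p`.
    have hk := Ideal.mul_mem_mul (X_sub_C_mem_pointIdeal a k) hlin
    rw [← pow_two] at hk
    convert add_mem (Ideal.mul_mem_left _ (X k) hp) hk using 1
    fin_cases k <;>
      simp [Fin.sum_univ_two, pderiv_X, Pi.single_apply] <;> ring

/-- The squared ideal is generated by pairwise products of the `X i - a i`. This is needed both for
the dual numbers, where those products vanish, and for the local ring. -/
theorem map_pointIdeal_sq_le {a : Fin 2 → ℂ} {R : Type*} [CommRing R]
    (φ : MvPolynomial (Fin 2) ℂ →+* R) (J : Ideal R)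
    (h : ∀ i j, φ (X i - C (a i)) * φ (X j - C (a j)) ∈ J) :
    (pointIdeal a ^ 2).map φ ≤ J := by
  rw [Ideal.map_pow, pointIdeal, Ideal.map_span, pow_two, Ideal.span_mul_span', Ideal.span_le]
  rintro _ ⟨_, ⟨_, ⟨i, rfl⟩, rfl⟩, _, ⟨_, ⟨j, rfl⟩, rfl⟩, rfl⟩
  exact h i j

/-- The homomorphism to the dual numbers given by the tangent vector `v` at `a`. -/
def tangentHom (a v : Fin 2 → ℂ) : MvPolynomial (Fin 2) ℂ →ₐ[ℂ] DualNumber ℂ :=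
  aeval fun i => TrivSqZeroExt.inl (a i) + TrivSqZeroExt.inr (v i)

/-- As `ε² = 0`, the second-order remainder of the Taylor expansion is killed. -/
theorem tangentHom_eq (a v : Fin 2 → ℂ) (h : MvPolynomial (Fin 2) ℂ) :
    tangentHom a v h = TrivSqZeroExt.inl (eval a h) +
      TrivSqZeroExt.inr (∑ i, eval a (pderiv i h) * v i) := by
  have hX (i) : tangentHom a v (X i - C (a i)) = TrivSqZeroExt.inr (v i) := by
    simp only [tangentHom, map_sub, aeval_X, algHom_C]
    exact add_sub_cancel_left _ _
  have hle : (pointIdeal a ^ 2).map (tangentHom a v).toRingHom ≤ ⊥ := by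
    refine map_pointIdeal_sq_le _ _ fun i j => ?_
    simp only [AlgHom.toRingHom_eq_coe, RingHom.coe_coe, hX]
    simp
  have h0 := hle (Ideal.mem_map_of_mem _ (sub_linear_mem_pointIdeal_sq a h))
  simp only [AlgHom.toRingHom_eq_coe, RingHom.coe_coe, Ideal.mem_bot, map_sub _ (_ - _),
    map_sub _ h, map_sum, map_mul, hX, sub_eq_iff_eq_add] at h0
  rw [h0, add_comm]
  simp only [algHom_C]
  ext
  · simp [TrivSqZeroExt.algebraMap_eq_inl]
  · simp [TrivSqZeroExt.algebraMap_eq_inl, mul_comm]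

theorem isUnit_algebraMap_localRingAt {a : Fin 2 → ℂ} {h : MvPolynomial (Fin 2) ℂ}
    (hh : eval a h ≠ 0) : IsUnit (algebraMap _ (LocalRingAt a) h) :=
  IsLocalization.map_units _
    (⟨h, by simpa [Ideal.mem_primeCompl_iff, RingHom.mem_ker] using hh⟩ :
      (RingHom.ker (eval a : MvPolynomial (Fin 2) ℂ →+* ℂ)).primeCompl)

/-- If `(f, g)` contains the square of the maximal ideal at a smooth point `a` of `g`, and the
tangent line of `g` is also tangent to `f`, then the intersection multiplicity is `2`. -/
theorem affineIntersectionMultiplicity_eq_two {a : Fin 2 → ℂ} {f g : MvPolynomial (Fin 2) ℂ}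
    (hm : ∀ i j, algebraMap _ (LocalRingAt a) (X i - C (a i)) *
      algebraMap _ (LocalRingAt a) (X j - C (a j)) ∈ localIdeal a f g)
    (hf : eval a f = 0) (hg : eval a g = 0) {k : ℂ}
    (hfg : ∀ i, eval a (pderiv i f) = k * eval a (pderiv i g))
    {i : Fin 2} (hi : eval a (pderiv i g) ≠ 0) :
    affineIntersectionMultiplicity a f g = 2 := by
  -- A direction spanning the kernel of the differential of `g` at `a`; the quotient is identified
  -- with the dual numbers through it.
  set v : Fin 2 → ℂ := ![-eval a (pderiv 1 g), eval a (pderiv 0 g)] with hv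
  have hunit (y : (RingHom.ker (eval a : MvPolynomial (Fin 2) ℂ →+* ℂ)).primeCompl) :
      IsUnit (tangentHom a v y) := by
    have := y.2
    rw [Ideal.mem_primeCompl_iff, RingHom.mem_ker] at this
    rw [TrivSqZeroExt.isUnit_iff_isUnit_fst, tangentHom_eq]
    simpa using this
  let ψ : LocalRingAt a →ₐ[ℂ] DualNumber ℂ := IsLocalization.liftAlgHom hunit
  have hψ (h) : ψ (algebraMap _ _ h) = tangentHom a v h := by
    simp only [ψ, IsLocalization.liftAlgHom_apply]
    exact IsLocalization.lift_eq _ h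
  have hsurj : Function.Surjective ψ := by
    have hvi : ∃ j, v j ≠ 0 := by
      fin_cases i
      · exact ⟨1, by simpa [hv] using hi⟩
      · exact ⟨0, by simpa [hv] using hi⟩
    obtain ⟨j, hj⟩ := hvi
    intro x
    refine ⟨algebraMap _ _ (C x.fst + C (x.snd / v j) * (X j - C (a j))), ?_⟩
    rw [hψ, tangentHom_eq]
    ext
    · simp
    · simp [pderiv_X, Pi.single_apply, apply_ite (eval a), hj, -Fin.sum_univ_two]
  have hsq : (pointIdeal a ^ 2).map (algebraMap _ (LocalRingAt a)) ≤ localIdeal a f g :=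
    map_pointIdeal_sq_le _ _ hm
  have htaylor (h : MvPolynomial (Fin 2) ℂ) :=
    hsq (Ideal.mem_map_of_mem _ (sub_linear_mem_pointIdeal_sq a h))
  have hgmem : algebraMap _ (LocalRingAt a) g ∈ localIdeal a f g := Ideal.subset_span (by simp)
  have hker : localIdeal a f g = RingHom.ker ψ := by
    apply le_antisymm
    · rw [localIdeal, Ideal.span_le]
      rintro _ (rfl | rfl)
      · rw [SetLike.mem_coe, RingHom.mem_ker, hψ, tangentHom_eq, hf]
        simp [hfg, hv]
        ring_nf
        simp
      · rw [SetLike.mem_coe, RingHom.mem_ker, hψ, tangentHom_eq, hg]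
        simp [hv]
        ring_nf
        simp
    · intro x hx
      obtain ⟨h, s, rfl⟩ := IsLocalization.exists_mk'_eq
        (RingHom.ker (eval a : MvPolynomial (Fin 2) ℂ →+* ℂ)).primeCompl x
      have hx' : tangentHom a v h = 0 := by
        rw [← hψ, ← IsLocalization.mk'_spec (LocalRingAt a) h s, map_mul, RingHom.mem_ker.1 hx,
          zero_mul]
      rw [IsLocalization.mk'_mem_iff]
      rw [tangentHom_eq] at hx'
      have h0 : eval a h = 0 := by simpa using congrArg TrivSqZeroExt.fst hx'
      have h1 : ∑ i, eval a (pderiv i h) * v i = 0 := by simpa using congrArg TrivSqZeroExt.snd hx'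
      -- Both differentials vanish on `v ≠ 0` in a plane and that of `g` is nonzero, so that of `h`
      -- is a multiple of it. Then `h - c g` has no terms of order below two and lies in the ideal.
      obtain ⟨c, hc⟩ : ∃ c, ∀ i, eval a (pderiv i h) = c * eval a (pderiv i g) := by
        refine ⟨eval a (pderiv i h) / eval a (pderiv i g), fun j => ?_⟩
        rw [div_mul_eq_mul_div, eq_div_iff hi]
        simp [hv, Fin.sum_univ_two] at h1
        fin_cases i <;> fin_cases j <;> simp <;>
          first | linear_combination h1 | linear_combination -h1
      have key := sub_mem (htaylor h) (Ideal.mul_mem_left _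
        (algebraMap (MvPolynomial (Fin 2) ℂ) (LocalRingAt a) (C c)) (htaylor g))
      rw [← map_mul, ← map_sub] at key
      have hsum : h = (h - C (eval a h) - ∑ i, C (eval a (pderiv i h)) * (X i - C (a i)) -
          C c * (g - C (eval a g) - ∑ i, C (eval a (pderiv i g)) * (X i - C (a i)))) + C c * g := by
        simp only [h0, hg, hc, map_mul, Finset.mul_sum, mul_sub]
        simp only [mul_assoc]
        simp
      rw [hsum, map_add]
      refine add_mem key ?_
      rw [map_mul]
      exact Ideal.mul_mem_left _ _ hgmem
  have e : (LocalRingAt a ⧸ localIdeal a f g) ≃ₗ[ℂ] DualNumber ℂ :=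
    ((Ideal.quotientEquivAlgOfEq ℂ hker).trans
      (Ideal.quotientKerAlgEquivOfSurjective hsurj)).toLinearEquiv
  rw [affineIntersectionMultiplicity, e.rank_eq]
  have : Module.rank ℂ (ℂ × ℂ) = 2 := by simp; norm_num
  rw [show Module.rank ℂ (DualNumber ℂ) = 2 from this]
  exact map_ofNat Cardinal.toENat 2

/-- Here `p₀, p₁, τ₀, τ₁` are the partials of `P, T` in the chart, and `hp`, `hτe` are Euler's
identities with `deg P = m + 1`, `deg T = m`. With `F`, `G` the two elements in `hF`, `hG`, one has
`p₁ (F + y G) - p G = p² (m p₁ - z τ₁)`, whose last factor is a unit because `z` is not. Multiplying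
`G` by `u`, then by `z`, yields `uz` and `z²`. -/
theorem mem_span_pair_of_local_equations {R : Type*} [CommRing R] [IsLocalRing R]
    {u z y p r p₀ p₁ τ τ₀ τ₁ : R} {m : ℕ} (hpu : p = u * r) (hr : IsUnit r) (hp₁ : IsUnit p₁)
    (hτ : IsUnit τ) (hz : z ∈ IsLocalRing.maximalIdeal R) (hm : IsUnit (m : R))
    (hp : p₀ + y * p₁ = (m + 1) * p) (hτe : τ₀ + y * τ₁ = m * τ) {J : Ideal R}
    (hF : p * p₀ + z * (p * τ₀ - τ * p₀) ∈ J) (hG : p * p₁ + z * (p * τ₁ - τ * p₁) ∈ J) :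
    u * u ∈ J ∧ u * z ∈ J ∧ z * z ∈ J := by
  have hu : u * u ∈ J := by
    have hunit : IsUnit (m * p₁ - z * τ₁) := by
      by_contra h
      have h1 := add_mem ((IsLocalRing.mem_maximalIdeal _).2 h) (Ideal.mul_mem_right τ₁ _ hz)
      rw [sub_add_cancel, IsLocalRing.mem_maximalIdeal] at h1
      exact h1 (hm.mul hp₁)
    rw [← Ideal.mul_unit_mem_iff_mem J ((hr.mul hr).mul hunit)]
    have h2 : p₁ * ((p * p₀ + z * (p * τ₀ - τ * p₀)) +
        y * (p * p₁ + z * (p * τ₁ - τ * p₁))) - p * (p * p₁ + z * (p * τ₁ - τ * p₁)) ∈ J :=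
      sub_mem (J.mul_mem_left _ (add_mem hF (J.mul_mem_left _ hG))) (J.mul_mem_left _ hG)
    convert h2 using 1
    have e : (p * p₀ + z * (p * τ₀ - τ * p₀)) + y * (p * p₁ + z * (p * τ₁ - τ * p₁)) =
        (m + 1) * p * p - z * p * τ := by
      linear_combination (p - z * τ) * hp + z * p * hτe
    rw [e, hpu]
    ring
  have hzu : u * z ∈ J := by
    rw [← Ideal.mul_unit_mem_iff_mem J (hτ.mul hp₁)]
    have h2 := sub_mem (J.mul_mem_right (r * (p₁ + z * τ₁)) hu) (J.mul_mem_left u hG)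
    convert h2 using 1
    rw [hpu]
    ring
  refine ⟨hu, hzu, ?_⟩
  rw [← Ideal.mul_unit_mem_iff_mem J (hτ.mul hp₁)]
  have h2 := sub_mem (J.mul_mem_right (r * (p₁ + z * τ₁)) hzu) (J.mul_mem_left z hG)
  convert h2 using 1
  rw [hpu]
  ring

theorem mul_mem_localIdeal {a : Fin 2 → ℂ} {p r p₀ p₁ τ τ₀ τ₁ : MvPolynomial (Fin 2) ℂ} {m : ℕ}
    (hm : m ≠ 0) (ha : a 1 = 0) (hpu : p = (X 0 - C (a 0)) * r) (hr : eval a r ≠ 0)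
    (hp₁ : eval a p₁ ≠ 0) (hτ : eval a τ ≠ 0)
    (hp : p₀ + X 0 * p₁ = ((m : MvPolynomial (Fin 2) ℂ) + 1) * p)
    (hτe : τ₀ + X 0 * τ₁ = (m : MvPolynomial (Fin 2) ℂ) * τ) (i j : Fin 2) :
    algebraMap _ (LocalRingAt a) (X i - C (a i)) * algebraMap _ (LocalRingAt a) (X j - C (a j)) ∈
      localIdeal a (p * p₀ + X 1 * (p * τ₀ - τ * p₀)) (p * p₁ + X 1 * (p * τ₁ - τ * p₁)) := by
  set J := localIdeal a (p * p₀ + X 1 * (p * τ₀ - τ * p₀)) (p * p₁ + X 1 * (p * τ₁ - τ * p₁))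
  set φ : MvPolynomial (Fin 2) ℂ →+* LocalRingAt a := algebraMap _ _
  have hz : X 1 - C (a 1) = (X 1 : MvPolynomial (Fin 2) ℂ) := by simp [ha]
  have hF : φ (p * p₀ + X 1 * (p * τ₀ - τ * p₀)) ∈ J := Ideal.subset_span (Or.inl rfl)
  have hG : φ (p * p₁ + X 1 * (p * τ₁ - τ * p₁)) ∈ J := Ideal.subset_span (Or.inr rfl)
  have hX : φ (X 1) ∈ IsLocalRing.maximalIdeal (LocalRingAt a) := by
    rw [← Localization.AtPrime.map_eq_maximalIdeal]
    exact Ideal.mem_map_of_mem _ (by simp [RingHom.mem_ker, ha])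
  have hmu : IsUnit (m : LocalRingAt a) := by
    rw [← map_natCast φ]
    exact isUnit_algebraMap_localRingAt (by simpa using hm)
  have hp' := congrArg φ hp
  have hτ' := congrArg φ hτe
  have hpu' := congrArg φ hpu
  simp only [map_add, map_mul, map_natCast, map_one, map_sub _ (_ * _)] at hF hG hp' hτ' hpu'
  obtain ⟨k1, k2, k3⟩ := mem_span_pair_of_local_equations hpu'
    (isUnit_algebraMap_localRingAt hr) (isUnit_algebraMap_localRingAt hp₁)
    (isUnit_algebraMap_localRingAt hτ) hX hmu hp' hτ' hF hG
  fin_cases i <;> fin_cases j <;> simp only [Fin.zero_eta, Fin.mk_one, hz]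
  · exact k1
  · exact k2
  · rw [mul_comm]; exact k2
  · exact k3

/-! ### The score curves in the chart `x = 1` -/

/-- The restriction `H(1, t)` of a polynomial in two variables. -/
def onLine : MvPolynomial (Fin 2) ℂ →ₐ[ℂ] Polynomial ℂ :=
  aeval ![1, Polynomial.X]

theorem derivative_onLine (H : MvPolynomial (Fin 2) ℂ) :
    (onLine H).derivative = onLine (pderiv 1 H) := by
  induction H using MvPolynomial.induction_on with
  | C c => simp [onLine, algHom_C]
  | add p q hp hq => simp [hp, hq]
  | mul_X p k hp =>
    rw [map_mul, Polynomial.derivative_mul, hp, pderiv_mul, map_add, map_mul, map_mul]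
    fin_cases k <;> simp [onLine, pderiv_X]

theorem eval_onLine (H : MvPolynomial (Fin 2) ℂ) (t : ℂ) :
    (onLine H).eval t = eval ![1, t] H := by
  have h : (Polynomial.aeval t).comp onLine = aeval ![1, t] := by
    ext i
    fin_cases i <;> simp [onLine]
  have h' := DFunLike.congr_fun h H
  rwa [MvPolynomial.aeval_eq_eval, AlgHom.comp_apply, Polynomial.coe_aeval_eq_eval] at h'

/-- The form `P P_i + z (P T_i - T P_i)` in three variables. -/
def scoreForm (P T : MvPolynomial (Fin 2) ℂ) (i : Fin 2) : MvPolynomial (Fin 3) ℂ :=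
  rename Fin.castSucc (P * pderiv i P) +
    X 2 * rename Fin.castSucc (P * pderiv i T - T * pderiv i P)

/-- In this chart `X 0` is `y` and `X 1` is `z`, so a form in `x, y` becomes a univariate polynomial
in `X 0`. -/
theorem dehomogenize_rename (H : MvPolynomial (Fin 2) ℂ) :
    dehomogenize 0 (rename Fin.castSucc H) = Polynomial.aeval (X 0) (onLine H) := by
  rw [dehomogenize, aeval_rename, onLine]
  change _ = ((Polynomial.aeval (X 0)).comp (aeval _)) H
  congr 1
  ext i : 1
  fin_cases i
  · simp
  · simp only [Fin.mk_one, AlgHom.comp_apply, aeval_X, Function.comp_apply, Matrix.cons_val_one,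
      Matrix.cons_val_fin_one, Polynomial.aeval_X]
    exact Fin.insertNth_apply_succAbove (α := fun _ => MvPolynomial (Fin 2) ℂ) 0 1 X 0

theorem dehomogenize_scoreForm (P T : MvPolynomial (Fin 2) ℂ) (i : Fin 2) :
    dehomogenize 0 (scoreForm P T i) =
      Polynomial.aeval (X 0) (onLine P) * Polynomial.aeval (X 0) (onLine (pderiv i P)) +
      X 1 * (Polynomial.aeval (X 0) (onLine P) * Polynomial.aeval (X 0) (onLine (pderiv i T)) -
        Polynomial.aeval (X 0) (onLine T) * Polynomial.aeval (X 0) (onLine (pderiv i P))) := by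
  have hX : dehomogenize 0 (X 2) = X 1 := by
    rw [dehomogenize, aeval_X]
    exact Fin.insertNth_apply_succAbove (α := fun _ => MvPolynomial (Fin 2) ℂ) 0 1 X 1
  have hadd (a b) : dehomogenize 0 (a + b) = dehomogenize 0 a + dehomogenize 0 b := map_add _ _ _
  have hmul (a b) : dehomogenize 0 (a * b) = dehomogenize 0 a * dehomogenize 0 b := map_mul _ _ _
  rw [scoreForm, hadd, hmul, hX, dehomogenize_rename, dehomogenize_rename]
  simp only [map_mul, map_sub]

theorem eval_aeval_X_zero (a : Fin 2 → ℂ) (q : Polynomial ℂ) :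
    eval a (Polynomial.aeval (X 0) q) = q.eval (a 0) := by
  rw [← MvPolynomial.coe_aeval_eq_eval, RingHom.coe_coe, ← Polynomial.aeval_algHom_apply]
  simp

theorem pderiv_aeval_X_zero (i : Fin 2) (q : Polynomial ℂ) :
    pderiv i (Polynomial.aeval (X 0 : MvPolynomial (Fin 2) ℂ) q) =
      Polynomial.aeval (X 0) q.derivative * pderiv i (X 0) := by
  rw [Derivation.map_aeval, smul_eq_mul]

theorem onLine_euler {P : MvPolynomial (Fin 2) ℂ} {d : ℕ} (hP : P.IsHomogeneous d) :
    onLine (pderiv 0 P) + Polynomial.X * onLine (pderiv 1 P) = (d : Polynomial ℂ) * onLine P := by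
  have h := congrArg onLine hP.sum_X_mul_pderiv
  simpa [Fin.sum_univ_two, onLine] using h

/-- At a simple root of `P` which is not a root of `T` the two score curves have intersection
multiplicity two. -/
theorem affineIntersectionMultiplicity_scoreForm {P T : MvPolynomial (Fin 2) ℂ} {m : ℕ}
    (hm : m ≠ 0) (hP : P.IsHomogeneous (m + 1)) (hT : T.IsHomogeneous m) {a : Fin 2 → ℂ}
    (ha : a 1 = 0) (h0 : (onLine P).eval (a 0) = 0) (h1 : (onLine P).derivative.eval (a 0) ≠ 0)
    (hT0 : (onLine T).eval (a 0) ≠ 0) :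
    affineIntersectionMultiplicity a (dehomogenize 0 (scoreForm P T 0))
      (dehomogenize 0 (scoreForm P T 1)) = 2 := by
  have hP1 := derivative_onLine P
  have heP : onLine (pderiv 0 P) + Polynomial.X * onLine (pderiv 1 P) =
      ((m : Polynomial ℂ) + 1) * onLine P := by
    simpa using onLine_euler hP
  have heT := onLine_euler hT
  have heP0 := congrArg (Polynomial.eval (a 0)) heP
  simp only [Polynomial.eval_add, Polynomial.eval_mul, Polynomial.eval_X, h0, mul_zero, ← hP1]
    at heP0
  obtain ⟨q, hq⟩ := Polynomial.dvd_iff_isRoot.2 h0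
  have hq0 : q.eval (a 0) ≠ 0 := by
    rw [hq] at h1
    simpa [Polynomial.derivative_mul] using h1
  rw [dehomogenize_scoreForm, dehomogenize_scoreForm]
  -- At the root Euler's identity reads `P_x = -a P_y`, which makes the linear part of `F` equal to
  -- `-a` times that of `G`.
  refine affineIntersectionMultiplicity_eq_two (k := -a 0) (i := 0) ?_ ?_ ?_ ?_ ?_
  · refine mul_mem_localIdeal hm ha (r := Polynomial.aeval (X 0) q) ?_ ?_ ?_ ?_ ?_ ?_
    · rw [hq, map_mul]
      simp [MvPolynomial.algebraMap_eq]
    · rwa [eval_aeval_X_zero]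
    · rwa [eval_aeval_X_zero, ← hP1]
    · rwa [eval_aeval_X_zero]
    · simpa using congrArg (Polynomial.aeval (X 0 : MvPolynomial (Fin 2) ℂ)) heP
    · simpa using congrArg (Polynomial.aeval (X 0 : MvPolynomial (Fin 2) ℂ)) heT
  · simp [eval_aeval_X_zero, ha, h0]
  · simp [eval_aeval_X_zero, ha, h0]
  · intro i
    simp only [map_add, map_sub, pderiv_mul, map_mul, eval_aeval_X_zero, pderiv_aeval_X_zero, h0,
      eval_X, ha, ← hP1]
    fin_cases i
    · simp [pderiv_X]
      linear_combination (onLine P).derivative.eval (a 0) * heP0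
    · simp [pderiv_X]
      linear_combination -(onLine T).eval (a 0) * heP0
  · simp [eval_aeval_X_zero, h0, ha, ← hP1, h1, pderiv_X]

theorem homogenization_add {h₁ h₂ : MvPolynomial (Fin 2) ℂ} {d : ℕ} (h1 : h₁.IsHomogeneous (d + 1))
    (h2 : h₂.IsHomogeneous d) (h0 : h₁ ≠ 0) :
    homogenization (h₁ + h₂) = rename Fin.castSucc h₁ + X 2 * rename Fin.castSucc h₂ := by
  have hc (k) : homogeneousComponent k (h₁ + h₂) =
      (if k = d + 1 then h₁ else 0) + (if k = d then h₂ else 0) := by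
    rw [map_add, homogeneousComponent_of_mem (n := d + 1) h1,
      homogeneousComponent_of_mem (n := d) h2]
  -- `homogenization` uses the actual total degree, so a vanishing `h₁` would change the power of
  -- `z`.
  have hdeg : (h₁ + h₂).totalDegree = d + 1 := by
    apply le_antisymm
    · exact (totalDegree_add _ _).trans
        (max_le h1.totalDegree_le (h2.totalDegree_le.trans (Nat.le_succ d)))
    · by_contra! hlt
      have := homogeneousComponent_eq_zero _ _ hlt
      rw [hc] at this
      simp [h0] at this
  rw [homogenization, hdeg, Finset.sum_range_succ, Finset.sum_range_succ, Finset.sum_eq_zero]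
  · simp [hc]
    ring
  · intro k hk
    have := Finset.mem_range.1 hk
    rw [hc, if_neg (by omega), if_neg (by omega)]
    simp

theorem isHomogeneous_covMatrix_apply {n : ℕ} (A B : Matrix (Fin n) (Fin n) ℂ) (i j : Fin n) :
    (covMatrix A B i j).IsHomogeneous 1 := by
  have h (k : Fin 2) (c : ℂ) : (X k * C c : MvPolynomial (Fin 2) ℂ).IsHomogeneous 1 := by
    simpa using (isHomogeneous_X ℂ k).mul (isHomogeneous_C (Fin 2) c)
  simpa [covMatrix] using (h 0 (A i j)).add (h 1 (B i j))

theorem isHomogeneous_det {σ : Type*} {R : Type*} [CommRing R] {n : ℕ}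
    (M : Matrix (Fin n) (Fin n) (MvPolynomial σ R)) (hM : ∀ i j, (M i j).IsHomogeneous 1) :
    M.det.IsHomogeneous n := by
  rw [Matrix.det_apply]
  refine IsHomogeneous.sum _ _ _ fun s _ => ?_
  have h := IsHomogeneous.prod Finset.univ (fun i => M (s i) i) (fun _ => 1) fun i _ => hM _ _
  rw [Units.smul_def, zsmul_eq_mul, ← map_intCast (C : R →+* MvPolynomial σ R)]
  simpa using (isHomogeneous_C σ ((Equiv.Perm.sign s : ℤ) : R)).mul h

theorem isHomogeneous_polyP {n : ℕ} (A B : Matrix (Fin n) (Fin n) ℂ) :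
    (polyP A B).IsHomogeneous n :=
  isHomogeneous_det _ (isHomogeneous_covMatrix_apply A B)

theorem isHomogeneous_polyT {m : ℕ} (A B S : Matrix (Fin (m + 1)) (Fin (m + 1)) ℂ) :
    (polyT A B S).IsHomogeneous m := by
  have hadj (i j) : ((covMatrix A B).adjugate i j).IsHomogeneous m := by
    have h := isHomogeneous_det ((covMatrix A B).submatrix j.succAbove i.succAbove)
      fun _ _ => isHomogeneous_covMatrix_apply A B _ _
    have hs : ((-1) ^ (j + i : ℕ) : MvPolynomial (Fin 2) ℂ) = C ((-1) ^ (j + i : ℕ)) := by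
      rw [map_pow, map_neg, map_one]
    rw [Matrix.adjugate_fin_succ_eq_det_submatrix, hs]
    exact h.C_mul _
  rw [polyT, Matrix.trace]
  refine IsHomogeneous.sum _ _ _ fun i _ => ?_
  rw [Matrix.diag_apply, Matrix.mul_apply]
  refine IsHomogeneous.sum _ _ _ fun j _ => ?_
  exact (hadj j i).C_mul (S i j)

theorem homogenization_scorePoly {m : ℕ} (hm : m ≠ 0) (A B S : Matrix (Fin (m + 1)) (Fin (m + 1)) ℂ)
    {i : Fin 2} (hi : pderiv i (polyP A B) ≠ 0) :
    homogenization (scorePoly A B S i) = scoreForm (polyP A B) (polyT A B S) i := by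
  have hP := isHomogeneous_polyP A B
  have hT := isHomogeneous_polyT A B S
  have hP0 : polyP A B ≠ 0 := by
    rintro h
    simp [h] at hi
  rw [scorePoly, add_sub_assoc, scoreForm, homogenization_add (d := 2 * m) _ _ (mul_ne_zero hP0 hi)]
  · have e : m + 1 + (m + 1 - 1) = 2 * m + 1 := by omega
    exact e ▸ hP.mul hP.pderiv
  · have e₁ : m + 1 + (m - 1) = 2 * m := by omega
    have e₂ : m + (m + 1 - 1) = 2 * m := by omega
    exact (e₁ ▸ hP.mul hT.pderiv).sub (e₂ ▸ hT.mul hP.pderiv)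

/-! ### Zeros of `P` and the points at infinity -/

theorem eval_smul_eq {σ : Type*} {P : MvPolynomial σ ℂ} {d : ℕ} (hP : P.IsHomogeneous d)
    (c : ℂ) (v : σ → ℂ) : eval (c • v) P = c ^ d * eval v P := by
  rw [eval_eq, eval_eq, Finset.mul_sum]
  refine Finset.sum_congr rfl fun s hs => ?_
  have hd : ∑ i ∈ s.support, s i = d := by
    have := hP (mem_support_iff.1 hs)
    simpa [Finsupp.weight_apply, Finsupp.sum] using this
  simp only [Pi.smul_apply, smul_eq_mul, mul_pow, Finset.prod_mul_distrib, Finset.prod_pow_eq_pow_sum,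
    hd]
  ring

theorem mk_mem_projRoots {P : MvPolynomial (Fin 2) ℂ} {d : ℕ} (hP : P.IsHomogeneous d)
    {v : Fin 2 → ℂ} (hv : v ≠ 0) : Projectivization.mk ℂ v hv ∈ projRoots P ↔ eval v P = 0 := by
  obtain ⟨c, hc⟩ := Projectivization.exists_smul_eq_mk_rep ℂ v hv
  rw [projRoots, Set.mem_ofPred_eq, ← hc, Units.smul_def, eval_smul_eq hP]
  simp

theorem eval_scoreForm (P T : MvPolynomial (Fin 2) ℂ) (i : Fin 2) {w : Fin 3 → ℂ} (hw : w 2 = 0) :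
    eval w (scoreForm P T i) = eval ![w 0, w 1] P * eval ![w 0, w 1] (pderiv i P) := by
  have h : w ∘ Fin.castSucc = ![w 0, w 1] := by
    ext j
    fin_cases j <;> rfl
  simp [scoreForm, eval_rename, hw, h]

theorem eval_eq_zero_of_mem_meetAtInfinity {P T : MvPolynomial (Fin 2) ℂ} {d : ℕ} (hd : d ≠ 0)
    (hP : P.IsHomogeneous d) {q : ProjPlane}
    (hq : q ∈ meetAtInfinity (scoreForm P T 0) (scoreForm P T 1)) :
    eval ![q.rep 0, q.rep 1] P = 0 := by
  obtain ⟨h0, h1, h2⟩ := hq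
  rw [eval_scoreForm _ _ _ h2] at h0 h1
  have he := congrArg (eval ![q.rep 0, q.rep 1]) hP.sum_X_mul_pderiv
  simp [Fin.sum_univ_two] at he
  -- Euler's identity multiplied by `P`.
  have : (d : ℂ) * eval ![q.rep 0, q.rep 1] P ^ 2 = 0 := by
    linear_combination q.rep 0 * h0 + q.rep 1 * h1 - eval ![q.rep 0, q.rep 1] P * he
  simpa [hd] using this

theorem appendZero_eq {w : Fin 3 → ℂ} (hw : w 2 = 0) : appendZero ![w 0, w 1] = w := by
  ext i
  fin_cases i <;> simp [appendZero, hw]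

theorem bijOn_toInfinity {P T : MvPolynomial (Fin 2) ℂ} {d : ℕ} (hd : d ≠ 0)
    (hP : P.IsHomogeneous d) :
    Set.BijOn toInfinity (projRoots P) (meetAtInfinity (scoreForm P T 0) (scoreForm P T 1)) := by
  refine ⟨fun q hq => ?_, (Projectivization.map_injective _ appendZero_injective).injOn,
    fun q hq => ?_⟩
  · have hv : appendZero q.rep ≠ 0 := fun h =>
      q.rep_nonzero (appendZero_injective (h.trans (map_zero _).symm))
    have hmk : toInfinity q = Projectivization.mk ℂ (appendZero q.rep) hv := by
      conv_lhs => rw [← q.mk_rep]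
      rfl
    obtain ⟨c, hc⟩ := Projectivization.exists_smul_eq_mk_rep ℂ _ hv
    rw [← hmk] at hc
    have h2 : (toInfinity q).rep 2 = 0 := by
      rw [← hc]
      simp [appendZero]
    have hr : ![(toInfinity q).rep 0, (toInfinity q).rep 1] = (c : ℂ) • q.rep := by
      rw [← hc]
      ext j
      fin_cases j <;> simp [Units.smul_def, appendZero]
    have hz : eval ![(toInfinity q).rep 0, (toInfinity q).rep 1] P = 0 := by
      rw [hr, eval_smul_eq hP, hq, mul_zero]
    exact ⟨by rw [eval_scoreForm _ _ _ h2, hz, zero_mul],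
      by rw [eval_scoreForm _ _ _ h2, hz, zero_mul], h2⟩
  · have hv : ![q.rep 0, q.rep 1] ≠ 0 := fun h =>
      q.rep_nonzero (by rw [← appendZero_eq hq.2.2, h, map_zero])
    refine ⟨Projectivization.mk ℂ _ hv,
      (mk_mem_projRoots hP hv).2 (eval_eq_zero_of_mem_meetAtInfinity hd hP hq), ?_⟩
    rw [toInfinity, Projectivization.map_mk]
    conv_rhs => rw [← q.mk_rep]
    congr 1
    exact appendZero_eq hq.2.2

theorem eval_zero_left {P : MvPolynomial (Fin 2) ℂ} {d : ℕ} (hP : P.IsHomogeneous d) (b : ℂ) :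
    eval ![0, b] P = b ^ d * eval ![0, 1] P := by
  rw [← eval_smul_eq hP]
  simp

theorem eval_eq_onLine {P : MvPolynomial (Fin 2) ℂ} {d : ℕ} (hP : P.IsHomogeneous d) {a : ℂ}
    (ha : a ≠ 0) (b : ℂ) : eval ![a, b] P = a ^ d * (onLine P).eval (b / a) := by
  rw [eval_onLine, ← eval_smul_eq hP]
  simp [mul_div_cancel₀ _ ha]

theorem ne_zero_of_eval_eq_zero {P : MvPolynomial (Fin 2) ℂ} {d : ℕ} (hP : P.IsHomogeneous d)
    (hP1 : eval ![0, 1] P ≠ 0) {v : Fin 2 → ℂ} (hv : v ≠ 0) (h : eval v P = 0) : v 0 ≠ 0 := by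
  intro h0
  have hv' : v = ![0, v 1] := by
    ext j
    fin_cases j <;> simp [h0]
  rw [hv', eval_zero_left hP] at h
  have h1 : v 1 = 0 := by by_contra hv1; exact mul_ne_zero (pow_ne_zero d hv1) hP1 h
  exact hv (by rw [hv', h1]; ext j; fin_cases j <;> rfl)

/-- Since `[0:1]` is not a zero, all zeros lie in the chart `x = 1` and correspond to the roots of
`P(1,t)`, which are distinct by separability. -/
theorem ncard_projRoots {P : MvPolynomial (Fin 2) ℂ} {d : ℕ} (hP : P.IsHomogeneous d)
    (hP1 : eval ![0, 1] P ≠ 0) (hdeg : (onLine P).natDegree = d) (hsep : (onLine P).Separable) :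
    (projRoots P).ncard = d := by
  have hne (t : ℂ) : ![1, t] ≠ 0 := fun h => by simpa using congrFun h 0
  have himg : projRoots P =
      (fun t => Projectivization.mk ℂ _ (hne t)) '' ((onLine P).roots.toFinset : Set ℂ) := by
    ext q
    constructor
    · intro hq
      have hq' : eval q.rep P = 0 := hq
      have h0 := ne_zero_of_eval_eq_zero hP hP1 q.rep_nonzero hq'
      have hrep : q.rep = ![q.rep 0, q.rep 1] := by
        ext j
        fin_cases j <;> rfl
      rw [hrep, eval_eq_onLine hP h0] at hq'
      refine ⟨q.rep 1 / q.rep 0, ?_, ?_⟩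
      · simpa [h0, hsep.ne_zero] using hq'
      · conv_rhs => rw [← q.mk_rep]
        rw [Projectivization.mk_eq_mk_iff']
        refine ⟨(q.rep 0)⁻¹, ?_⟩
        ext j
        fin_cases j <;> simp [h0, div_eq_inv_mul]
    · rintro ⟨t, ht, rfl⟩
      rw [mk_mem_projRoots hP, ← eval_onLine]
      simpa [hsep.ne_zero] using ht
  rw [himg, Set.ncard_image_of_injective, Set.ncard_coe_finset,
    Multiset.toFinset_card_of_nodup (Polynomial.nodup_roots hsep),
    IsAlgClosed.card_roots_eq_natDegree, hdeg]
  intro s t hst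
  obtain ⟨c, hc⟩ := (Projectivization.mk_eq_mk_iff' _ _ _ _ _).1 hst
  have h0 := congrFun hc 0
  have h1 := congrFun hc 1
  simp at h0 h1
  rw [← h1, h0, one_mul]

theorem intersectionMultiplicity_scoreForm {P T : MvPolynomial (Fin 2) ℂ} {m : ℕ} (hm : m ≠ 0)
    (hP : P.IsHomogeneous (m + 1)) (hT : T.IsHomogeneous m) (hP1 : eval ![0, 1] P ≠ 0)
    (hcop : IsCoprime (onLine P) ((onLine P).derivative * onLine T)) {q : ProjPlane}
    (hq : q ∈ meetAtInfinity (scoreForm P T 0) (scoreForm P T 1)) :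
    intersectionMultiplicity q (scoreForm P T 0) (scoreForm P T 1) = 2 := by
  have hz := eval_eq_zero_of_mem_meetAtInfinity (Nat.succ_ne_zero m) hP hq
  have h0 : q.rep 0 ≠ 0 := by
    have hv : ![q.rep 0, q.rep 1] ≠ 0 := fun h =>
      q.rep_nonzero (by rw [← appendZero_eq hq.2.2, h, map_zero])
    simpa using ne_zero_of_eval_eq_zero hP hP1 hv hz
  have hchart : firstChart q = 0 := by simp [firstChart, h0]
  rw [eval_eq_onLine hP h0] at hz
  have hz' : (onLine P).eval (q.rep 1 / q.rep 0) = 0 := by simpa [h0] using hz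
  obtain ⟨a, b, hab⟩ := hcop
  have hab' := congrArg (Polynomial.eval (q.rep 1 / q.rep 0)) hab
  simp [hz'] at hab'
  have ha0 : chartPoint 0 q 0 = q.rep 1 / q.rep 0 := rfl
  rw [intersectionMultiplicity, hchart]
  refine affineIntersectionMultiplicity_scoreForm hm hP hT ?_ ?_ ?_ ?_
  · have : chartPoint 0 q 1 = q.rep 2 / q.rep 0 := rfl
    rw [this, hq.2.2, zero_div]
  · rwa [ha0]
  · rw [ha0]
    intro h
    simp [h] at hab'
  · rw [ha0]
    intro h
    simp [h] at hab'

theorem finsum_mem_eq_ncard_mul {α : Type*} {M : Type*} [CommSemiring M] {s : Set α} (hs : s.Finite)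
    {f : α → M} {c : M} (hf : ∀ q ∈ s, f q = c) : ∑ᶠ q ∈ s, f q = s.ncard * c := by
  rw [finsum_mem_congr rfl hf, finsum_mem_eq_finite_toFinset_sum _ hs, Finset.sum_const,
    Set.ncard_eq_toFinset_card s hs, nsmul_eq_mul]

/-! ### The pencil `A + tB` over a general ring, and its base change -/

section LinePencil

variable {ι : Type*} [Fintype ι] [DecidableEq ι] {R R' : Type*} [CommRing R] [CommRing R']

/-- The pencil `A + t B`, with entries in `R[t]`. -/
def linePencil (A B : Matrix ι ι R) : Matrix ι ι (Polynomial R) :=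
  (Polynomial.X : Polynomial R) • B.map Polynomial.C + A.map Polynomial.C

/-- The polynomial `tr (S adj (A + t B))`. -/
def lineTrace (A B S : Matrix ι ι R) : Polynomial R :=
  (S.map Polynomial.C * (linePencil A B).adjugate).trace

theorem linePencil_map (φ : R →+* R') (A B : Matrix ι ι R) :
    linePencil (A.map φ) (B.map φ) = (Polynomial.mapRingHom φ).mapMatrix (linePencil A B) := by
  ext i j : 1
  simp [linePencil]

theorem det_linePencil_map (φ : R →+* R') (A B : Matrix ι ι R) :
    (linePencil (A.map φ) (B.map φ)).det = (linePencil A B).det.map φ := by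
  rw [linePencil_map, ← RingHom.map_det, Polynomial.coe_mapRingHom]

theorem lineTrace_map (φ : R →+* R') (A B S : Matrix ι ι R) :
    lineTrace (A.map φ) (B.map φ) (S.map φ) = (lineTrace A B S).map φ := by
  have hS : (S.map φ).map Polynomial.C = 
      (Polynomial.mapRingHom φ).mapMatrix (S.map Polynomial.C) := by
    ext i j : 1
    simp
  rw [lineTrace, linePencil_map, hS, ← RingHom.map_adjugate, ← map_mul, lineTrace,
    ← Polynomial.coe_mapRingHom, AddMonoidHom.map_trace]
  rfl

end LinePencil

theorem onLine_mapMatrix_covMatrix {n : ℕ} (A B : Matrix (Fin n) (Fin n) ℂ) :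
    onLine.toRingHom.mapMatrix (covMatrix A B) = linePencil A B := by
  ext i j : 1
  simp [covMatrix, linePencil, onLine, algHom_C, add_comm]

theorem onLine_polyP {n : ℕ} (A B : Matrix (Fin n) (Fin n) ℂ) :
    onLine (polyP A B) = (linePencil A B).det := by
  rw [← onLine_mapMatrix_covMatrix, ← RingHom.map_det]
  rfl

theorem onLine_polyT {n : ℕ} (A B S : Matrix (Fin n) (Fin n) ℂ) :
    onLine (polyT A B S) = lineTrace A B S := by
  have hS : S.map Polynomial.C = onLine.toRingHom.mapMatrix (S.map C) := by
    ext i j : 1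
    simp [onLine, algHom_C]
  rw [lineTrace, ← onLine_mapMatrix_covMatrix, hS, ← RingHom.map_adjugate, ← map_mul, polyT]
  exact AddMonoidHom.map_trace onLine.toRingHom _

theorem eval_polyP {n : ℕ} (A B : Matrix (Fin n) (Fin n) ℂ) (v : Fin 2 → ℂ) :
    eval v (polyP A B) = (v 0 • A + v 1 • B).det := by
  rw [polyP, RingHom.map_det]
  congr 1
  ext i j : 1
  simp [covMatrix]

theorem natDegree_onLine_polyP {n : ℕ} {A B : Matrix (Fin n) (Fin n) ℂ} (hB : B.det ≠ 0) :
    (onLine (polyP A B)).natDegree = n := by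
  rw [onLine_polyP]
  apply le_antisymm
  · simpa [linePencil] using Polynomial.natDegree_det_X_add_C_le B A
  · apply Polynomial.le_natDegree_of_ne_zero
    have := Polynomial.coeff_det_X_add_C_card B A
    rw [Fintype.card_fin] at this
    rwa [linePencil, this]

/-- Euler's identity at the `i`-th basis vector says that the `i`-th partial there is `d` times the
value of `P`. -/
theorem pderiv_ne_zero_of_eval_single {P : MvPolynomial (Fin 2) ℂ} {d : ℕ} (hd : d ≠ 0)
    (hP : P.IsHomogeneous d) (i : Fin 2) (h : eval (Pi.single i 1) P ≠ 0) : pderiv i P ≠ 0 := by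
  intro h0
  have he := congrArg (eval (Pi.single i 1)) hP.sum_X_mul_pderiv
  fin_cases i <;> simp_all [Fin.sum_univ_two]

/-- The single coprimality hypothesis encodes both separability of `P(1,t)` and the absence of
common roots with `T(1,t)`. -/
theorem scoreCurves_of_isCoprime {n : ℕ} (hn : 2 ≤ n) {A B S : Matrix (Fin n) (Fin n) ℂ}
    (hA : A.det ≠ 0) (hB : B.det ≠ 0)
    (hcop : IsCoprime (linePencil A B).det
      ((linePencil A B).det.derivative * lineTrace A B S)) :
    (meetAtInfinity (curveF A B S) (curveG A B S)).ncard = n ∧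
      Set.BijOn toInfinity (projRoots (polyP A B))
        (meetAtInfinity (curveF A B S) (curveG A B S)) ∧
      (∀ q ∈ meetAtInfinity (curveF A B S) (curveG A B S),
        intersectionMultiplicity q (curveF A B S) (curveG A B S) = 2) ∧
      ∑ᶠ q ∈ meetAtInfinity (curveF A B S) (curveG A B S),
        intersectionMultiplicity q (curveF A B S) (curveG A B S) = 2 * (n : ℕ∞) := by
  obtain ⟨m, rfl⟩ : ∃ m, n = m + 1 := ⟨n - 1, by omega⟩
  have hm : m ≠ 0 := by omega
  have hP := isHomogeneous_polyP A B
  have hT := isHomogeneous_polyT A B S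
  have h01 : eval ![0, 1] (polyP A B) ≠ 0 := by simpa [eval_polyP] using hB
  rw [← onLine_polyP, ← onLine_polyT] at hcop
  have hF : curveF A B S = scoreForm (polyP A B) (polyT A B S) 0 :=
    homogenization_scorePoly hm A B S
      (pderiv_ne_zero_of_eval_single m.succ_ne_zero hP 0 (by simpa [eval_polyP] using hA))
  have hG : curveG A B S = scoreForm (polyP A B) (polyT A B S) 1 :=
    homogenization_scorePoly hm A B S
      (pderiv_ne_zero_of_eval_single m.succ_ne_zero hP 1 (by simpa [eval_polyP] using hB))
  rw [hF, hG]
  have hbij := bijOn_toInfinity (T := polyT A B S) m.succ_ne_zero hP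
  have hcard : (meetAtInfinity (scoreForm (polyP A B) (polyT A B S) 0)
      (scoreForm (polyP A B) (polyT A B S) 1)).ncard = m + 1 := by
    rw [← hbij.image_eq, hbij.injOn.ncard_image]
    exact ncard_projRoots hP h01 (natDegree_onLine_polyP hB) hcop.of_mul_right_left
  have hmult (q) (hq : q ∈ meetAtInfinity (scoreForm (polyP A B) (polyT A B S) 0)
      (scoreForm (polyP A B) (polyT A B S) 1)) :=
    intersectionMultiplicity_scoreForm hm hP hT h01 hcop hq
  refine ⟨hcard, hbij, hmult, ?_⟩
  -- Infinite sets have `ncard` zero, so the positive count also gives finiteness.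
  rw [finsum_mem_eq_ncard_mul (Set.finite_of_ncard_ne_zero (by omega)) hmult, hcard, mul_comm]

/-! ### Genericity through a resultant -/

/-- The `k`-th matrix of the generic triple of symmetric matrices. -/
def genericMatrix (n : ℕ) (k : Fin 3) :
    Matrix (Fin n) (Fin n) (MvPolynomial (Fin 3 × Sym2 (Fin n)) ℂ) :=
  Matrix.of fun i j => X (k, s(i, j))

theorem genericMatrix_map_eval {n : ℕ} (c : Fin 3 × Sym2 (Fin n) → ℂ) (k : Fin 3) :
    (genericMatrix n k).map (eval c) = symmetricMatrix fun e => c (k, e) := by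
  ext i j
  simp [genericMatrix, symmetricMatrix]

/-- The determinant of the generic pencil on the line `x = 1`. -/
def genericDet (n : ℕ) : Polynomial (MvPolynomial (Fin 3 × Sym2 (Fin n)) ℂ) :=
  (linePencil (genericMatrix n 0) (genericMatrix n 1)).det

/-- The polynomial whose common roots with `genericDet` are to be avoided. -/
def genericCofactor (n : ℕ) : Polynomial (MvPolynomial (Fin 3 × Sym2 (Fin n)) ℂ) :=
  (genericDet n).derivative * lineTrace (genericMatrix n 0) (genericMatrix n 1) (genericMatrix n 2)

/-- A polynomial on the space of triples whose non-vanishing ensures general position. -/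
def genericPolynomial (n : ℕ) : MvPolynomial (Fin 3 × Sym2 (Fin n)) ℂ :=
  (genericMatrix n 0).det * (genericMatrix n 1).det *
    (genericDet n).resultant (genericCofactor n) n (genericCofactor n).natDegree

section Specialization

variable {n : ℕ} {c : Fin 3 × Sym2 (Fin n) → ℂ} {A B S : Matrix (Fin n) (Fin n) ℂ}

/-- A resultant with fixed formal degrees commutes with evaluating the coefficients, even if actual
degrees drop. -/
theorem eval_genericPolynomial (hA : symmetricMatrix (fun e => c (0, e)) = A)
    (hB : symmetricMatrix (fun e => c (1, e)) = B) (hS : symmetricMatrix (fun e => c (2, e)) = S) :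
    eval c (genericPolynomial n) = A.det * B.det *
      (linePencil A B).det.resultant ((linePencil A B).det.derivative * lineTrace A B S) n
        (genericCofactor n).natDegree := by
  rw [← genericMatrix_map_eval] at hA hB hS
  subst hA hB hS
  rw [det_linePencil_map, lineTrace_map, Polynomial.derivative_map, ← Polynomial.map_mul,
    genericPolynomial, map_mul, map_mul, RingHom.map_det, RingHom.map_det]
  congr 1
  exact (Polynomial.resultant_map_map _ _ _ _ _).symm

theorem natDegree_le_genericCofactor (hA : symmetricMatrix (fun e => c (0, e)) = A)
    (hB : symmetricMatrix (fun e => c (1, e)) = B) (hS : symmetricMatrix (fun e => c (2, e)) = S) :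
    ((linePencil A B).det.derivative * lineTrace A B S).natDegree ≤
      (genericCofactor n).natDegree := by
  rw [← genericMatrix_map_eval] at hA hB hS
  subst hA hB hS
  rw [det_linePencil_map, lineTrace_map, Polynomial.derivative_map, ← Polynomial.map_mul]
  exact Polynomial.natDegree_map_le

end Specialization

theorem exists_symmetricMatrix_eq {n : ℕ} (M : Matrix (Fin n) (Fin n) ℂ) (hM : M.IsSymm) :
    ∃ c, symmetricMatrix c = M :=
  ⟨Sym2.lift ⟨M, fun i j => hM.apply j i⟩, by ext i j; simp [symmetricMatrix]⟩

theorem exists_eval_genericPolynomial_ne_zero (n : ℕ) :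
    ∃ c, eval c (genericPolynomial n) ≠ 0 := by
  -- The eigenvalues `1, …, n` are distinct, so the pencil determinant is separable, and nonzero, so
  -- `det A ≠ 0`.
  set lam : Fin n → ℂ := fun i => (i : ℂ) + 1 with hlam
  have hinj : Function.Injective fun i => -lam i := by
    intro i j h
    simpa [hlam, Fin.val_inj] using h
  obtain ⟨cA, hcA⟩ := exists_symmetricMatrix_eq (Matrix.diagonal lam) (Matrix.isSymm_diagonal lam)
  obtain ⟨cI, hcI⟩ := exists_symmetricMatrix_eq (1 : Matrix (Fin n) (Fin n) ℂ) Matrix.isSymm_one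
  let c : Fin 3 × Sym2 (Fin n) → ℂ := fun x => if x.1 = 0 then cA x.2 else cI x.2
  have hA : symmetricMatrix (fun e => c (0, e)) = Matrix.diagonal lam := by simpa [c] using hcA
  have hB : symmetricMatrix (fun e => c (1, e)) = 1 := by simpa [c] using hcI
  have hS : symmetricMatrix (fun e => c (2, e)) = 1 := by simpa [c] using hcI
  have hpen : linePencil (Matrix.diagonal lam) 1 =
      Matrix.diagonal fun i => Polynomial.X - Polynomial.C (-lam i) := by
    ext i j : 1
    by_cases h : i = j <;> simp [linePencil, h]
  have hdet : (linePencil (Matrix.diagonal lam) 1).det =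
      ∏ i, (Polynomial.X - Polynomial.C (-lam i)) := by rw [hpen, Matrix.det_diagonal]
  -- The trace of the adjugate of a diagonal matrix is the sum of products omitting one factor,
  -- which is the product rule for the determinant.
  have htr : lineTrace (Matrix.diagonal lam) 1 1 =
      (linePencil (Matrix.diagonal lam) 1).det.derivative := by
    rw [hdet, lineTrace, hpen, Matrix.adjugate_diagonal, Polynomial.derivative_prod_finset]
    simp [Matrix.trace]
  have hmonic : (linePencil (Matrix.diagonal lam) 1).det.Monic := by
    rw [hdet]
    exact Polynomial.monic_prod_X_sub_C _ _
  have hdeg : (linePencil (Matrix.diagonal lam) 1).det.natDegree = n := by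
    rw [hdet, Polynomial.natDegree_prod_of_monic _ _ fun i _ => Polynomial.monic_X_sub_C _]
    simp
  have hsep : (linePencil (Matrix.diagonal lam) 1).det.Separable := by
    rw [hdet]
    exact Polynomial.separable_prod_X_sub_C_iff.2 hinj
  refine ⟨c, ?_⟩
  -- This reduces nonvanishing to `P'(t)² ≠ 0` at each root `t` of `P(1,t)`.
  have hres := Polynomial.resultant_eq_prod_eval _ _ _ (natDegree_le_genericCofactor hA hB hS)
    (IsAlgClosed.splits (linePencil (Matrix.diagonal lam) 1).det)
  rw [hdeg] at hres
  rw [eval_genericPolynomial hA hB hS, hres, hmonic.leadingCoeff, htr]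
  refine mul_ne_zero (mul_ne_zero ?_ ?_) (mul_ne_zero ?_ ?_)
  · rw [Matrix.det_diagonal, Finset.prod_ne_zero_iff]
    intro i _
    exact Nat.cast_add_one_ne_zero _
  · simp
  · simp
  · refine Multiset.prod_ne_zero fun hmem => ?_
    obtain ⟨t, ht, h0⟩ := Multiset.mem_map.1 hmem
    have ht' : (linePencil (Matrix.diagonal lam) 1).det.eval t = 0 :=
      (Polynomial.mem_roots'.1 ht).2
    rw [Polynomial.eval_mul, mul_self_eq_zero] at h0
    exact hsep.eval₂_derivative_ne_zero (RingHom.id ℂ) ht' h0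

end CovarianceCurves

end

open CovarianceCurves in
theorem mainTheorem3 (n : ℕ) (hn : 2 ≤ n) :
    HoldsGenerically n fun A B S =>
      (meetAtInfinity (curveF A B S) (curveG A B S)).ncard = n ∧
      Set.BijOn toInfinity (projRoots (polyP A B))
        (meetAtInfinity (curveF A B S) (curveG A B S)) ∧
      (∀ q ∈ meetAtInfinity (curveF A B S) (curveG A B S),
        intersectionMultiplicity q (curveF A B S) (curveG A B S) = 2) ∧
      ∑ᶠ q ∈ meetAtInfinity (curveF A B S) (curveG A B S),
        intersectionMultiplicity q (curveF A B S) (curveG A B S) = 2 * (n : ℕ∞) := by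
  refine ⟨_, ⟨{genericPolynomial n}, rfl⟩, ?_, fun c hc => ?_⟩
  · obtain ⟨c, hc⟩ := exists_eval_genericPolynomial_ne_zero n
    exact ⟨c, fun h => hc (h _ (Finset.mem_singleton_self _))⟩
  · have h0 : MvPolynomial.eval c (genericPolynomial n) ≠ 0 := fun h => hc fun p hp => by
      rwa [Finset.mem_singleton.1 hp]
    rw [eval_genericPolynomial rfl rfl rfl] at h0
    have hB := right_ne_zero_of_mul (left_ne_zero_of_mul h0)
    refine scoreCurves_of_isCoprime hn (left_ne_zero_of_mul (left_ne_zero_of_mul h0)) hB ?_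
    -- The resultant is a combination of the two polynomials; being a nonzero constant, it yields a
    -- Bézout relation after division. One formal degree must be nonzero, and here `n` is.
    obtain ⟨a, b, -, -, hab⟩ := Polynomial.exists_mul_add_mul_eq_C_resultant _ _
      (onLine_polyP _ _ ▸ (natDegree_onLine_polyP hB).le)
      (natDegree_le_genericCofactor (c := c) rfl rfl rfl) (Or.inl (by omega))
    obtain ⟨u, hu⟩ := (right_ne_zero_of_mul h0).isUnit.map Polynomial.C
    rw [← hu] at hab
    refine ⟨↑u⁻¹ * a, ↑u⁻¹ * b, ?_⟩
    rw [mul_assoc, mul_assoc, ← mul_add, mul_comm a, mul_comm b, hab, Units.inv_mul]
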